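/- A trinity is a triangulation (multiple edges allowed) of a connected closed oriented surface whose vertices are coloured red, green and blue so that no edge joins two vertices of the same colour; write $R$, $E$, $V$ for the sets of red, green and blue vertices. An edge has the colour missing at its two endpoints. A triangle is black if the vertex colours blue, green, red follow each other clockwise around it, and white otherwise; every edge separates a white from a black triangle. A planar trinity is a trinity on the sphere with a chosen white triangle, called outer; the vertices of the outer triangle are called the roots. For $X\in\{R,E,V\}$ let $G_X^*$ be the directed graph with vertex set $X$ that has one arrow for each edge $\epsilon$ opposite to vertices of the colour of $X$: the arrow starts at the vertex in $X$ of the black triangle adjacent to $\epsilon$, crosses $\epsilon$, and ends at the vertex in $X$ of the white triangle adjacent to $\epsilon$. Thus the arrows of $G_X^*$ correspond to the white triangles. The graph $G_X^*$ is embedded in the oriented sphere, and its root is the root of the trinity that lies in $X$. A spanning arborescence of $G_X^*$ is a spanning tree all of whose edges point away from the root. The clocked arborescence of $G_X^*$ is the set of arrows selected by the following greedy search. Start at the root, at the corner of the outer triangle, with no arrow selected, and turn counter-clockwise around the root, looking at the ends of arrows one by one. Whenever the tail of an arrow is met whose end point has not been reached yet (it is neither the root nor the end point of a selected arrow), select this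 arrow, go along it, and continue turning counter-clockwise around its end point, beginning just after the selected arrow. When a full turn has been made at a vertex other than the root, backtrack along the selected arrow that ends there and continue turning at its starting point. All other arrow ends are passed over. A Tutte matching of a planar trinity is a perfect matching between the non-outer white triangles and the non-root vertices (of all three colours) in which every triangle is matched to one of its own vertices. Theorem. Let $\mathcal T$ be a planar trinity. The clocked arborescences of $G_R^*$, $G_E^*$ and $G_V^*$ are spanning arborescences of these graphs. View each of them as a matching between white triangles and vertices of the respective colour, by matching the white triangle that an arrow crosses to the vertex at which the arrow ends. Then the union of these three matchings is a Tutte matching of $\mathcal T$. -/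

import Mathlib

/-- The three colours. -/
inductive Colour : Type
  | red
  | green
  | blue
  deriving DecidableEq

namespace Colour

instance : Fintype Colour := ⟨{red, green, blue}, fun c => by cases c <;> simp⟩

/-- Going counter-clockwise around a white triangle, its vertices are red, blue, green, in this
cyclic order; `c.next` is the colour that follows `c`. (Around a black triangle the counter-clockwise
order is red, green, blue.) -/
def next : Colour → Colour
  | red => blue
  | blue => green
  | green => red

/-- The colour that precedes `c` in the cyclic order red, blue, green. -/
def prev : Colour → Colour
  | red => green
  | green => blue
  | blue => red

end Colour

/-- A trinity: a triangulation of a connected, closed, oriented surface with vertices properly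
coloured red, green, blue, given by its gluing pattern. `W` and `B` are the sets of white and black
triangles. Each triangle has one vertex and one edge of every colour; the edge of colour `c` is the
one opposite to the vertex of colour `c`. Each edge of the triangulation lies between a white and a
black triangle, and `cross c w` is the black triangle on the other side of the edge of colour `c`
of the white triangle `w`; an edge is determined by its colour and the white triangle next to it.
(Multiple edges are allowed.) -/
structure Trinity (W B : Type*) where
  cross : Colour → W ≃ B
  /-- The surface is connected: one can get from any triangle to any other across edges. -/
  connected : ∀ s t : W ⊕ B,
    Relation.EqvGen (fun x y => ∃ c w, x = Sum.inl w ∧ y = Sum.inr (cross c w)) s t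

namespace Trinity

variable {W B : Type*} (T : Trinity W B)

/-- Every triangle has exactly one corner at a vertex of colour `c`. `T.rot c` takes each triangle to
the next one in the counter-clockwise direction around its vertex of colour `c`.
At the vertex of colour `c`, a white triangle is left counter-clockwise through its edge of colour
`c.next`, and a black triangle through its edge of colour `c.prev`. -/
def rot (c : Colour) : Equiv.Perm (W ⊕ B) where
  toFun := Sum.elim (fun w => Sum.inr (T.cross c.next w)) (fun b => Sum.inl ((T.cross c.prev).symm b))
  invFun := Sum.elim (fun w => Sum.inr (T.cross c.prev w)) (fun b => Sum.inl ((T.cross c.next).symm b))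
  left_inv := by rintro (w | b) <;> simp
  right_inv := by rintro (w | b) <;> simp

/-- The vertices of colour `c`: two triangles share their vertex of colour `c` when one can be
rotated into the other about it. -/
def Vertex (c : Colour) : Type _ :=
  Quotient (Equiv.Perm.SameCycle.setoid (T.rot c))

/-- The vertex of colour `c` of a triangle. -/
def vertexOf (c : Colour) (t : W ⊕ B) : T.Vertex c :=
  Quotient.mk (Equiv.Perm.SameCycle.setoid (T.rot c)) t

/-- The set of all vertices of the trinity. -/
abbrev AnyVertex : Type _ := (c : Colour) × T.Vertex c

/-- Euler characteristic: vertices minus edges plus triangles. -/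
noncomputable def eulerChar : ℤ :=
  (Nat.card T.AnyVertex : ℤ) - (Nat.card (Colour × W) : ℤ) + (Nat.card (W ⊕ B) : ℤ)

/- The directed graph `G_c^*`: its vertices are the vertices of colour `c`, and it has one arrow for
each edge of colour `c`, that is, one arrow for each white triangle `w`. That arrow starts at the
vertex of colour `c` of the black triangle `T.cross c w`, crosses the edge of colour `c` of `w`, and
ends at the vertex of colour `c` of `w`. -/

/-- The end point of the arrow of `G_c^*` that lies across the white triangle `w`. -/
def head (c : Colour) (w : W) : T.Vertex c := T.vertexOf c (Sum.inl w)

/-- The starting point of the arrow of `G_c^*` that lies across the white triangle `w`. -/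
def tail (c : Colour) (w : W) : T.Vertex c := T.vertexOf c (Sum.inr (T.cross c w))

/- Around a vertex of colour `c`, each white triangle contains the head end of exactly one arrow of
`G_c^*` and each black triangle contains the tail end of exactly one. So the half-edges of the
ribbon graph `G_c^*` are the elements of `W ⊕ B`, and `T.rot c` is the counter-clockwise cyclic
ordering of the half-edges around each vertex. -/

/-- The arrow of `G_c^*` to which a half-edge belongs. -/
def arrowOf (c : Colour) : W ⊕ B → W :=
  Sum.elim id (T.cross c).symm

/-- The other half of the same arrow of `G_c^*`. -/
def opposite (c : Colour) : W ⊕ B → W ⊕ B :=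
  Sum.elim (fun w => Sum.inr (T.cross c w)) (fun b => Sum.inl ((T.cross c).symm b))

open Classical in
/-- One step of the counter-clockwise tour around the perimeter of the subgraph of `G_c^*` with
arrow set `A`: on meeting an arrow of `A` we go along it and turn on at its other end point,
and an arrow outside `A` is passed over. -/
noncomputable def perimeterStep (c : Colour) (A : Set W) (h : W ⊕ B) : W ⊕ B :=
  if T.arrowOf c h ∈ A then T.rot c (T.opposite c h) else T.rot c h

end Trinity

/-- A planar trinity: a trinity on the sphere with a chosen outer white triangle. -/
structure PlanarTrinity (W B : Type*) extends Trinity W B where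
  outer : W
  spherical : toTrinity.eulerChar = 2

namespace PlanarTrinity

variable {W B : Type*} (T : PlanarTrinity W B)

/-- The roots are the vertices of the outer white triangle. -/
def root (c : Colour) : T.Vertex c := T.vertexOf c (Sum.inl T.outer)

/-- A set `A` of arrows of `G_c^*` is a spanning arborescence: no arrow of `A` ends at the root,
exactly one ends at every other vertex, and every vertex can be reached from the root by a directed
path in `A`. -/
def IsSpanningArborescence (c : Colour) (A : Set W) : Prop :=
  (∀ w ∈ A, T.head c w ≠ T.root c) ∧
  (∀ v : T.Vertex c, v ≠ T.root c → ∃! w, w ∈ A ∧ T.head c w = v) ∧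
  (∀ v : T.Vertex c,
    Relation.ReflTransGen (fun x y => ∃ w ∈ A, T.tail c w = x ∧ T.head c w = y) (T.root c) v)

/-- Selection of an arrow in the greedy search: if the search, having selected the arrows `A`, stands
at the half-edge `h`, and `h` is the tail end of an arrow whose end point is neither the root nor
the end point of an arrow in `A`, then that arrow is added to `A`. -/
def select (c : Colour) (A : Set W) (h : W ⊕ B) : Set W :=
  A ∪ {w | h = Sum.inr (T.cross c w) ∧ T.head c w ≠ T.root c ∧
    ∀ w' ∈ A, T.head c w' ≠ T.head c w}

/-- The greedy search in `G_c^*`: the arrows selected and the half-edge at which we stand after `k`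
steps. The search starts at the root inside the outer triangle and turns counter-clockwise. When an
arrow is selected, the search continues at its end point; when a full turn has been made at a
vertex, the arrow leading to that vertex is met again, and the search backtracks along it. -/
noncomputable def search (c : Colour) : ℕ → Set W × (W ⊕ B)
  | 0 => (∅, Sum.inl T.outer)
  | k + 1 =>
    (T.select c (search c k).1 (search c k).2,
      T.perimeterStep c (T.select c (search c k).1 (search c k).2) (search c k).2)

/-- The clocked arborescence of `G_c^*`: the set of arrows selected by the greedy search. -/
def clocked (c : Colour) : Set W := {w | ∃ k, w ∈ (T.search c k).1}

/-- A set of arrows of `G_c^*` viewed as a matching between white triangles and vertices of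
colour `c`: each white triangle crossed by an arrow is matched to the vertex where it ends. -/
def asMatching (c : Colour) (A : Set W) : Set (W × T.AnyVertex) :=
  {p | ∃ w ∈ A, p = (w, ⟨c, T.head c w⟩)}

/-- A Tutte matching: a perfect matching between the non-outer white triangles and the non-root
vertices in which triangles are matched to incident vertices. -/
def IsTutteMatching (M : Set (W × T.AnyVertex)) : Prop :=
  (∀ p ∈ M, p.1 ≠ T.outer ∧ p.2.2 ≠ T.root p.2.1 ∧ T.vertexOf p.2.1 (Sum.inl p.1) = p.2.2) ∧
  (∀ w : W, w ≠ T.outer → ∃! v : T.AnyVertex, (w, v) ∈ M) ∧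
  (∀ v : T.AnyVertex, v.2 ≠ T.root v.1 → ∃! w : W, (w, v) ∈ M)

end PlanarTrinity

/-!
Since every vertex of `G_c^*` has as many incoming as outgoing arrows, the search reaches every
half-edge, and its arrows form a spanning arborescence. The order in which it meets the half-edges
also matches every vertex of the other two colours, except the roots, to a white triangle that it
passes just before it first comes to that vertex; by Euler's formula this gives a Tutte matching
`M_c`, which contains the clocked arborescence of `G_c^*`. It remains to show that the three
matchings `M_c` agree.

On the sphere, the difference of two Tutte matchings, as a flow through the corners of the white
triangles, is the gradient of a function `h` of the black triangles. Where `h` is larger than next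
to the outer triangle, we have a region that is entered, turning counter-clockwise around vertices,
only at corners of the first matching. No such region exists for `M_c`: the search would have to
enter it for the first time at a corner outside `M_c`, or along a selected arrow, and the second
possibility is excluded by an infinite descent. Hence `h` is constant.
-/

namespace Colour

@[simp] theorem next_next (c : Colour) : c.next.next = c.prev := by cases c <;> rfl
@[simp] theorem prev_prev (c : Colour) : c.prev.prev = c.next := by cases c <;> rfl
@[simp] theorem next_prev (c : Colour) : c.next.prev = c := by cases c <;> rfl
@[simp] theorem prev_next (c : Colour) : c.prev.next = c := by cases c <;> rfl
@[simp] theorem next_ne (c : Colour) : c.next ≠ c := by cases c <;> decide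
@[simp] theorem prev_ne (c : Colour) : c.prev ≠ c := by cases c <;> decide
@[simp] theorem next_ne_prev (c : Colour) : c.next ≠ c.prev := by cases c <;> decide

theorem eq_or_eq_next_or_eq_prev (c d : Colour) : d = c ∨ d = c.next ∨ d = c.prev := by
  cases c <;> cases d <;> simp [next, prev]

theorem exists_ne_and_ne (c d : Colour) : ∃ e, c ≠ e ∧ d ≠ e := by
  cases c <;> cases d <;> decide

theorem card_eq_three : Nat.card Colour = 3 := by
  rw [Nat.card_eq_fintype_card]; rfl

theorem sum_next_sub_prev {M : Type*} [AddCommGroup M] (f : Colour → M) :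
    ∑ c : Colour, (f c.next - f c.prev) = 0 := by
  have prev_bijective : Function.Bijective prev :=
    Function.bijective_iff_has_inverse.2 ⟨next, prev_next, next_prev⟩
  have sum_next := prev_bijective.sum_comp fun c => f c.prev
  simp only [prev_prev] at sum_next
  rw [Finset.sum_sub_distrib, sum_next, sub_self]

end Colour

theorem perm_apply_mem_iff_of_mapsTo {α : Type*} [Finite α] {σ : Equiv.Perm α} {s : Set α}
    (hs : Set.MapsTo σ s s) {x : α} : σ x ∈ s ↔ x ∈ s := by
  refine ⟨fun hx => ?_, fun hx => hs hx⟩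
  obtain ⟨y, hy, hyx⟩ := ((s.toFinite.injOn_iff_bijOn_of_mapsTo hs).1 σ.injective.injOn).surjOn hx
  exact σ.injective hyx ▸ hy

theorem bijOn_of_surjOn_of_ncard_le {α β : Type*} {f : α → β} {s : Set α} {t : Set β}
    (hs : s.Finite) (hst : s.ncard ≤ t.ncard) (hf : Set.SurjOn f s t) : Set.BijOn f s t := by
  have himage : t = f '' s := Set.eq_of_subset_of_ncard_le hf
    ((Set.ncard_image_le hs).trans hst) (hs.image f)
  subst himage
  exact ⟨Set.mapsTo_image f s,
    Set.injOn_of_ncard_image_eq ((Set.ncard_image_le hs).antisymm hst) hs, hf⟩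

namespace Trinity

variable {W B : Type*} (T : Trinity W B)

theorem eq_of_cross_invariant {α : Type*} (F : W ⊕ B → α)
    (hF : ∀ c w, F (Sum.inl w) = F (Sum.inr (T.cross c w))) (s t : W ⊕ B) : F s = F t := by
  induction T.connected s t with
  | rel x y h => obtain ⟨c, w, rfl, rfl⟩ := h; exact hF c w
  | refl x => rfl
  | symm x y _ ih => exact ih.symm
  | trans x y z _ _ h₁ h₂ => exact h₁.trans h₂

@[simp] theorem rot_inl (c : Colour) (w : W) :
    T.rot c (Sum.inl w) = Sum.inr (T.cross c.next w) := rfl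
@[simp] theorem rot_inr (c : Colour) (b : B) :
    T.rot c (Sum.inr b) = Sum.inl ((T.cross c.prev).symm b) := rfl
@[simp] theorem arrowOf_inl (c : Colour) (w : W) : T.arrowOf c (Sum.inl w) = w := rfl
@[simp] theorem arrowOf_inr (c : Colour) (b : B) :
    T.arrowOf c (Sum.inr b) = (T.cross c).symm b := rfl
@[simp] theorem opposite_inl (c : Colour) (w : W) :
    T.opposite c (Sum.inl w) = Sum.inr (T.cross c w) := rfl
@[simp] theorem opposite_inr (c : Colour) (b : B) :
    T.opposite c (Sum.inr b) = Sum.inl ((T.cross c).symm b) := rfl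

@[simp] theorem arrowOf_opposite (c : Colour) (h : W ⊕ B) :
    T.arrowOf c (T.opposite c h) = T.arrowOf c h := by
  rcases h with w | b <;> simp

@[simp] theorem opposite_opposite (c : Colour) (h : W ⊕ B) :
    T.opposite c (T.opposite c h) = h := by
  rcases h with w | b <;> simp

theorem vertexOf_eq_iff {c : Colour} {s t : W ⊕ B} :
    T.vertexOf c s = T.vertexOf c t ↔ (T.rot c).SameCycle s t :=
  Quotient.eq (r := Equiv.Perm.SameCycle.setoid (T.rot c))

@[simp] theorem vertexOf_rot (c : Colour) (t : W ⊕ B) :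
    T.vertexOf c (T.rot c t) = T.vertexOf c t :=
  T.vertexOf_eq_iff.2 (Equiv.Perm.sameCycle_apply_left.2 (.refl _ _))

theorem vertexOf_cross {c d : Colour} (h : d ≠ c) (w : W) :
    T.vertexOf c (Sum.inr (T.cross d w)) = T.vertexOf c (Sum.inl w) := by
  rcases c.eq_or_eq_next_or_eq_prev d with rfl | rfl | rfl
  · exact absurd rfl h
  · exact T.vertexOf_rot c (Sum.inl w)
  · simpa using (T.vertexOf_rot c (Sum.inr (T.cross c.prev w))).symm

theorem vertexOf_surjective (c : Colour) : Function.Surjective (T.vertexOf c) :=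
  Quotient.mk_surjective

theorem exists_vertexOf_inl_eq {c : Colour} (v : T.Vertex c) :
    ∃ w, T.vertexOf c (Sum.inl w) = v := by
  obtain ⟨w | b, rfl⟩ := T.vertexOf_surjective c v
  · exact ⟨w, rfl⟩
  · exact ⟨_, T.vertexOf_rot c (Sum.inr b)⟩

theorem mem_of_vertexOf_eq [Finite W] [Finite B] {c : Colour} {X : Set (W ⊕ B)}
    (hX : Set.MapsTo (T.rot c) X X) {s t : W ⊕ B} (hs : s ∈ X)
    (hst : T.vertexOf c s = T.vertexOf c t) : t ∈ X := by
  obtain ⟨n, -, rfl⟩ := (T.vertexOf_eq_iff.1 hst).exists_pow_eq'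
  rw [Equiv.Perm.coe_pow]
  exact hX.iterate n hs

instance finite_vertex [Finite W] [Finite B] (c : Colour) : Finite (T.Vertex c) :=
  Finite.of_surjective _ (T.vertexOf_surjective c)

theorem exists_entering_of_leaving [Finite W] {c : Colour} {S : Set B} {w : W}
    (hprev : T.cross c.prev w ∈ S) (hnext : T.cross c.next w ∉ S) :
    ∃ w', T.vertexOf c (Sum.inl w') = T.vertexOf c (Sum.inl w) ∧
      T.cross c.next w' ∈ S ∧ T.cross c.prev w' ∉ S := by
  by_contra! hS
  let turn : Equiv.Perm W := (T.cross c.next).trans (T.cross c.prev).symm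
  have cross_turn (x : W) : T.cross c.prev (turn x) = T.cross c.next x := by simp [turn]
  have vertexOf_turn (x : W) :
      T.vertexOf c (Sum.inl (turn x)) = T.vertexOf c (Sum.inl x) := by
    rw [← T.vertexOf_cross c.prev_ne, cross_turn, T.vertexOf_cross c.next_ne]
  let X := {x | T.vertexOf c (Sum.inl x) = T.vertexOf c (Sum.inl w) ∧ T.cross c.prev x ∈ S}
  have hX : Set.MapsTo turn.symm X X := by
    rintro x ⟨hx, hxS⟩
    obtain ⟨x, rfl⟩ := turn.surjective x
    rw [vertexOf_turn] at hx
    rw [cross_turn] at hxS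
    simpa [X] using ⟨hx, hS x hx hxS⟩
  have hw : turn w ∈ X :=
    (perm_apply_mem_iff_of_mapsTo hX).1 (by simpa [X] using hprev)
  exact hnext (cross_turn w ▸ hw.2)

/-- Strong connectivity of `G_c^*`, which holds since in-degrees equal out-degrees. -/
theorem mem_of_forall_head_mem [Finite W] {c : Colour} {X : Set (T.Vertex c)} {v₀ : T.Vertex c}
    (hv₀ : v₀ ∈ X) (hX : ∀ w, T.tail c w ∈ X → T.head c w ∈ X) (v : T.Vertex c) : v ∈ X := by
  let σ : Equiv.Perm W := (T.cross c.next).trans (T.cross c).symm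
  have tail_σ (w : W) : T.tail c (σ w) = T.head c w := by
    simpa [σ, tail, head] using T.vertexOf_cross c.next_ne w
  have head_mem_iff (w : W) : T.head c w ∈ X ↔ T.tail c w ∈ X := by
    rw [← tail_σ]
    exact perm_apply_mem_iff_of_mapsTo (s := {w | T.tail c w ∈ X})
      fun w hw => by simpa only [Set.mem_ofPred_eq, tail_σ] using hX w hw
  have mem_iff := T.eq_of_cross_invariant (fun t => T.vertexOf c t ∈ X) fun d w => by
    by_cases hd : d = c
    · subst hd
      exact propext (head_mem_iff w)
    · simp only [T.vertexOf_cross hd]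
  obtain ⟨s, rfl⟩ := T.vertexOf_surjective c v₀
  obtain ⟨t, rfl⟩ := T.vertexOf_surjective c v
  exact (mem_iff s t).mp hv₀

theorem perimeterStep_of_mem {c : Colour} {A : Set W} {h : W ⊕ B} (hA : T.arrowOf c h ∈ A) :
    T.perimeterStep c A h = T.rot c (T.opposite c h) :=
  if_pos hA

theorem perimeterStep_of_notMem {c : Colour} {A : Set W} {h : W ⊕ B} (hA : T.arrowOf c h ∉ A) :
    T.perimeterStep c A h = T.rot c h :=
  if_neg hA

theorem perimeterStep_congr {c : Colour} {A A' : Set W} {h : W ⊕ B}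
    (hA : T.arrowOf c h ∈ A ↔ T.arrowOf c h ∈ A') :
    T.perimeterStep c A h = T.perimeterStep c A' h := by
  by_cases h' : T.arrowOf c h ∈ A' <;> simp [perimeterStep, hA, h']

theorem perimeterStep_injective (c : Colour) (A : Set W) :
    Function.Injective (T.perimeterStep c A) := by
  classical
  have hinv : Function.Involutive
      fun h => if T.arrowOf c h ∈ A then T.opposite c h else h := fun h => by
    by_cases hA : T.arrowOf c h ∈ A <;> simp [hA]
  convert (T.rot c).injective.comp hinv.injective using 1
  ext1 h
  by_cases hA : T.arrowOf c h ∈ A <;> simp [perimeterStep, hA]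

end Trinity

/-! ### The greedy search -/

namespace PlanarTrinity

variable {W B : Type*} {T : PlanarTrinity W B} {c : Colour}

variable (T) in
/-- The arrows selected during the first `k` steps of the search in `G_c^*`. -/
noncomputable def arrows (c : Colour) (k : ℕ) : Set W := (T.search c k).1

variable (T) in
/-- The half-edge of `G_c^*` reached after `k` steps of the search. -/
noncomputable def pos (c : Colour) (k : ℕ) : W ⊕ B := (T.search c k).2

variable (T) in
/-- The search in `G_c^*` has stood at the vertex `v` during its first `k` steps. -/
def Visited (c : Colour) (k : ℕ) (v : T.Vertex c) : Prop := ∃ j ≤ k, T.vertexOf c (T.pos c j) = v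

variable (T) in
/-- The search in `G_c^*` selects the arrow `w` when leaving its `k`-th position. -/
def SelectedAt (c : Colour) (k : ℕ) (w : W) : Prop :=
  T.pos c k = Sum.inr (T.cross c w) ∧ T.head c w ≠ T.root c ∧
    ∀ w' ∈ T.arrows c k, T.head c w' ≠ T.head c w

theorem pos_zero : T.pos c 0 = Sum.inl T.outer := rfl

theorem pos_succ {k : ℕ} :
    T.pos c (k + 1) = T.perimeterStep c (T.arrows c (k + 1)) (T.pos c k) := rfl

theorem mem_arrows_succ {k : ℕ} {w : W} :
    w ∈ T.arrows c (k + 1) ↔ w ∈ T.arrows c k ∨ T.SelectedAt c k w := Iff.rfl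

theorem mem_arrows_iff {k : ℕ} {w : W} : w ∈ T.arrows c k ↔ ∃ j < k, T.SelectedAt c j w := by
  induction k with
  | zero => simp [arrows, search]
  | succ k ih => rw [mem_arrows_succ, ih, Nat.exists_lt_succ_right]

theorem mem_clocked_iff {w : W} : w ∈ T.clocked c ↔ ∃ k, T.SelectedAt c k w := by
  refine ⟨fun ⟨k, hw⟩ => ?_, fun ⟨k, hw⟩ => ⟨k + 1, mem_arrows_succ.2 (.inr hw)⟩⟩
  obtain ⟨j, -, hj⟩ := mem_arrows_iff.1 hw
  exact ⟨j, hj⟩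

theorem SelectedAt.pos_succ {k : ℕ} {w : W} (hw : T.SelectedAt c k w) :
    T.pos c (k + 1) = T.rot c (Sum.inl w) := by
  have hmem : w ∈ T.arrows c (k + 1) := mem_arrows_succ.2 (.inr hw)
  rw [PlanarTrinity.pos_succ, hw.1, T.perimeterStep_of_mem (by simpa using hmem)]
  simp

theorem SelectedAt.visited_head {j k : ℕ} {w : W} (hw : T.SelectedAt c j w) (hjk : j < k) :
    T.Visited c k (T.head c w) :=
  ⟨j + 1, hjk, by rw [hw.pos_succ]; exact T.vertexOf_rot c (Sum.inl w)⟩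

theorem visited_iff {k : ℕ} {v : T.Vertex c} :
    T.Visited c k v ↔ v = T.root c ∨ ∃ w ∈ T.arrows c k, T.head c w = v := by
  constructor
  · rintro ⟨j, hjk, rfl⟩
    induction j using Nat.strong_induction_on with
    | _ j ih =>
    obtain _ | j := j
    · exact .inl rfl
    by_cases hA : T.arrowOf c (T.pos c j) ∈ T.arrows c (j + 1)
    · rw [pos_succ, T.perimeterStep_of_mem hA, T.vertexOf_rot]
      rcases hpos : T.pos c j with w | b <;> rw [hpos] at hA
      · obtain ⟨i, hij, hi⟩ := mem_arrows_iff.1 hA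
        simpa [hi.1] using ih i hij (hij.le.trans hjk)
      · obtain ⟨i, hij, hi⟩ := mem_arrows_iff.1 hA
        exact .inr ⟨_, mem_arrows_iff.2 ⟨i, hij.trans_le hjk, hi⟩, rfl⟩
    · rw [pos_succ, T.perimeterStep_of_notMem hA, T.vertexOf_rot]
      exact ih j j.lt_succ_self (Nat.le_of_succ_le hjk)
  · rintro (rfl | ⟨w, hw, rfl⟩)
    · exact ⟨0, k.zero_le, rfl⟩
    · obtain ⟨j, hjk, hj⟩ := mem_arrows_iff.1 hw
      exact hj.visited_head hjk

theorem selectedAt_iff {k : ℕ} {w : W} :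
    T.SelectedAt c k w ↔
      T.pos c k = Sum.inr (T.cross c w) ∧ ¬ T.Visited c k (T.head c w) := by
  rw [visited_iff]
  push Not
  rfl

theorem SelectedAt.le_of_head_eq {j k : ℕ} {w w' : W} (hw : T.SelectedAt c j w)
    (hw' : T.SelectedAt c k w') (h : T.head c w = T.head c w') : k ≤ j := by
  by_contra! hjk
  exact (selectedAt_iff.1 hw').2 (h ▸ hw.visited_head hjk)

theorem eq_of_mem_clocked {w w' : W} (hw : w ∈ T.clocked c) (hw' : w' ∈ T.clocked c)
    (h : T.head c w = T.head c w') : w = w' := by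
  obtain ⟨j, hj⟩ := mem_clocked_iff.1 hw
  obtain ⟨k, hk⟩ := mem_clocked_iff.1 hw'
  obtain rfl : j = k := (hk.le_of_head_eq hj h.symm).antisymm (hj.le_of_head_eq hk h)
  exact (T.cross c).injective (Sum.inr_injective (hj.1.symm.trans hk.1))

theorem head_ne_root_of_mem_clocked {w : W} (hw : w ∈ T.clocked c) : T.head c w ≠ T.root c := by
  obtain ⟨k, hk⟩ := mem_clocked_iff.1 hw
  exact hk.2.1

theorem arrowOf_pos_mem_iff (k : ℕ) :
    T.arrowOf c (T.pos c k) ∈ T.arrows c (k + 1) ↔ T.arrowOf c (T.pos c k) ∈ T.clocked c := by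
  refine ⟨fun hw => ⟨_, hw⟩, fun hw => ?_⟩
  obtain ⟨j, hj⟩ := mem_clocked_iff.1 hw
  by_cases hjk : j ≤ k
  · exact mem_arrows_iff.2 ⟨j, Nat.lt_succ_of_le hjk, hj⟩
  have hkj : k ≤ j := (not_le.1 hjk).le
  have hhead := (selectedAt_iff.1 hj).2
  rcases hpos : T.pos c k with w | b <;> rw [hpos] at hhead
  · exact absurd ⟨k, hkj, by rw [hpos]; rfl⟩ hhead
  · refine mem_arrows_succ.2 (.inr (selectedAt_iff.2 ⟨by simp [hpos], ?_⟩))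
    exact fun ⟨i, hik, hi⟩ => hhead ⟨i, hik.trans hkj, hi⟩

theorem pos_succ_eq (k : ℕ) :
    T.pos c (k + 1) = T.perimeterStep c (T.clocked c) (T.pos c k) :=
  pos_succ.trans (T.perimeterStep_congr (arrowOf_pos_mem_iff k))

variable (T) in
/-- The time at which the search in `G_c^*` first stands at the half-edge `h`. Every half-edge is
reached (`pos_surjective`), so this is never the junk value `sInf ∅ = 0`. -/
noncomputable def visitTime (c : Colour) (h : W ⊕ B) : ℕ := sInf {k | T.pos c k = h}

theorem visitTime_pos_le (k : ℕ) : T.visitTime c (T.pos c k) ≤ k := Nat.sInf_le rfl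

theorem pos_visitTime_of_mem_range {h : W ⊕ B} (hh : h ∈ Set.range (T.pos c)) :
    T.pos c (T.visitTime c h) = h :=
  Nat.sInf_mem hh

theorem SelectedAt.visitTime_eq {k : ℕ} {w : W} (hw : T.SelectedAt c k w) :
    T.visitTime c (Sum.inr (T.cross c w)) = k := by
  have hle := hw.1 ▸ visitTime_pos_le k
  have hsel : T.SelectedAt c (T.visitTime c (Sum.inr (T.cross c w))) w :=
    selectedAt_iff.2 ⟨pos_visitTime_of_mem_range ⟨k, hw.1⟩,
      fun ⟨i, hi, h⟩ => (selectedAt_iff.1 hw).2 ⟨i, hi.trans hle, h⟩⟩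
  exact hle.antisymm (hsel.le_of_head_eq hw rfl)

theorem selectedAt_visitTime {w : W} (hw : w ∈ T.clocked c) :
    T.SelectedAt c (T.visitTime c (Sum.inr (T.cross c w))) w := by
  obtain ⟨k, hk⟩ := mem_clocked_iff.1 hw
  rwa [hk.visitTime_eq]

theorem perimeterStep_mem_range {h : W ⊕ B} (hh : h ∈ Set.range (T.pos c)) :
    T.perimeterStep c (T.clocked c) h ∈ Set.range (T.pos c) := by
  obtain ⟨k, rfl⟩ := hh
  exact ⟨k + 1, pos_succ_eq k⟩

theorem rot_inl_mem_range {w : W} (hw : w ∈ T.clocked c) :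
    T.rot c (Sum.inl w) ∈ Set.range (T.pos c) :=
  ⟨_, (selectedAt_visitTime hw).pos_succ⟩

theorem visitTime_tail_lt {w : W} (hw : w ∈ T.clocked c) {h : W ⊕ B}
    (hh : h ∈ Set.range (T.pos c)) (heq : T.vertexOf c h = T.head c w) :
    T.visitTime c (Sum.inr (T.cross c w)) < T.visitTime c h := by
  by_contra! hle
  exact (selectedAt_iff.1 (selectedAt_visitTime hw)).2
    ⟨_, hle, by rw [pos_visitTime_of_mem_range hh, heq]⟩

section Finite

variable [Finite W] [Finite B]

/-- The search backtracks along each selected arrow: take the selected arrow `w` without this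
property that was selected last. All selected arrows starting at the head of `w` are traversed both
ways, so the search makes a full turn there and meets `w` again. -/
theorem inl_mem_range_of_mem_clocked {w : W} (hw : w ∈ T.clocked c) :
    Sum.inl w ∈ Set.range (T.pos c) := by
  by_contra hpos
  obtain ⟨w, ⟨hw, hpos⟩, hlast⟩ := Set.exists_max_image
    {w | w ∈ T.clocked c ∧ Sum.inl w ∉ Set.range (T.pos c)}
    (fun w => T.visitTime c (Sum.inr (T.cross c w))) (Set.toFinite _) ⟨w, hw, hpos⟩
  let X := {h | h ∈ Set.range (T.pos c) ∧ T.vertexOf c h = T.head c w}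
  have hX : Set.MapsTo (T.rot c) X X := by
    rintro h ⟨hh, hv⟩
    refine ⟨?_, by rwa [T.vertexOf_rot]⟩
    by_cases hA : T.arrowOf c h ∈ T.clocked c
    · obtain a | b := h
      · exact rot_inl_mem_range hA
      · obtain ⟨a, rfl⟩ := (T.cross c).surjective b
        simp only [Trinity.arrowOf_inr, Equiv.symm_apply_apply] at hA
        have hlt := visitTime_tail_lt hw hh hv
        have ha : Sum.inl a ∈ Set.range (T.pos c) := by
          by_contra ha
          exact hlt.not_ge (hlast a ⟨hA, ha⟩)
        simpa [T.perimeterStep_of_mem (h := Sum.inl a) hA] using perimeterStep_mem_range ha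
    · rw [← T.perimeterStep_of_notMem hA]
      exact perimeterStep_mem_range hh
  have hrot : T.rot c (Sum.inl w) ∈ X := ⟨rot_inl_mem_range hw, T.vertexOf_rot c _⟩
  exact hpos (T.mem_of_vertexOf_eq hX hrot (T.vertexOf_rot c _)).1

theorem opposite_mem_range {h : W ⊕ B} (hA : T.arrowOf c h ∈ T.clocked c) :
    T.opposite c h ∈ Set.range (T.pos c) := by
  obtain w | b := h
  · exact ⟨_, (selectedAt_visitTime hA).1⟩
  · exact inl_mem_range_of_mem_clocked hA

theorem mapsTo_rot_range_pos :
    Set.MapsTo (T.rot c) (Set.range (T.pos c)) (Set.range (T.pos c)) := by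
  intro h hh
  by_cases hA : T.arrowOf c h ∈ T.clocked c
  · have hstep := T.perimeterStep_of_mem (h := T.opposite c h) (by rwa [T.arrowOf_opposite])
    rw [T.opposite_opposite] at hstep
    exact hstep ▸ perimeterStep_mem_range (opposite_mem_range hA)
  · rw [← T.perimeterStep_of_notMem hA]
    exact perimeterStep_mem_range hh

variable (T) in
theorem pos_surjective (c : Colour) : Function.Surjective (T.pos c) := by
  have mem_range_of_visited {h : W ⊕ B} (hh : ∃ k, T.vertexOf c (T.pos c k) = T.vertexOf c h) :
      h ∈ Set.range (T.pos c) := by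
    obtain ⟨k, hk⟩ := hh
    exact T.mem_of_vertexOf_eq mapsTo_rot_range_pos ⟨k, rfl⟩ hk
  intro h
  refine mem_range_of_visited (T.mem_of_forall_head_mem
    (X := {v | ∃ k, T.vertexOf c (T.pos c k) = v}) (v₀ := T.root c) ⟨0, rfl⟩ (fun w hw => ?_) _)
  obtain ⟨k, hk⟩ : Sum.inr (T.cross c w) ∈ Set.range (T.pos c) := mem_range_of_visited hw
  by_contra hhead
  have hsel : T.SelectedAt c k w := selectedAt_iff.2 ⟨hk, fun ⟨j, _, hj⟩ => hhead ⟨j, hj⟩⟩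
  obtain ⟨j, -, hj⟩ := hsel.visited_head k.lt_succ_self
  exact hhead ⟨j, hj⟩

theorem exists_mem_clocked_head_eq {v : T.Vertex c} (hv : v ≠ T.root c) :
    ∃ w ∈ T.clocked c, T.head c w = v := by
  obtain ⟨h, rfl⟩ := T.vertexOf_surjective c v
  obtain ⟨k, rfl⟩ := T.pos_surjective c h
  obtain ⟨w, hw, hwv⟩ := (visited_iff.1 ⟨k, le_rfl, rfl⟩).resolve_left hv
  exact ⟨w, ⟨k, hw⟩, hwv⟩

variable (T) in
theorem isSpanningArborescence_clocked (c : Colour) :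
    T.IsSpanningArborescence c (T.clocked c) := by
  refine ⟨fun w hw => head_ne_root_of_mem_clocked hw, fun v hv => ?_, fun v => ?_⟩
  · obtain ⟨w, hw, rfl⟩ := exists_mem_clocked_head_eq hv
    exact ⟨w, ⟨hw, rfl⟩, fun w' hw' => eq_of_mem_clocked hw'.1 hw hw'.2⟩
  · obtain ⟨h, rfl⟩ := T.vertexOf_surjective c v
    obtain ⟨k, rfl⟩ := T.pos_surjective c h
    induction k using Nat.strong_induction_on with
    | _ k ih =>
    rcases visited_iff.1 ⟨k, le_rfl, rfl⟩ with hroot | ⟨w, hw, hhead⟩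
    · rw [hroot]
    · obtain ⟨j, hjk, hj⟩ := mem_arrows_iff.1 hw
      exact (ih j hjk).tail ⟨w, ⟨k, hw⟩, congrArg (T.vertexOf c) hj.1.symm, hhead⟩


theorem pos_visitTime (h : W ⊕ B) : T.pos c (T.visitTime c h) = h :=
  pos_visitTime_of_mem_range (T.pos_surjective c h)

theorem visitTime_perimeterStep {h : W ⊕ B}
    (hh : T.perimeterStep c (T.clocked c) h ≠ Sum.inl T.outer) :
    T.visitTime c (T.perimeterStep c (T.clocked c) h) = T.visitTime c h + 1 := by
  have hle := visitTime_pos_le (T := T) (c := c) (T.visitTime c h + 1)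
  rw [pos_succ_eq, pos_visitTime] at hle
  obtain ⟨k, hk⟩ : ∃ k, T.visitTime c (T.perimeterStep c (T.clocked c) h) = k + 1 := by
    refine Nat.exists_eq_succ_of_ne_zero fun hzero => hh ?_
    rw [← pos_visitTime (c := c) (T.perimeterStep c (T.clocked c) h), hzero, pos_zero]
  have hpos : T.pos c k = h := T.perimeterStep_injective c _ <| by
    rw [← pos_succ_eq, ← hk, pos_visitTime]
  have hge := hpos ▸ visitTime_pos_le (T := T) (c := c) k
  omega

theorem visitTime_cross_next_of_mem {w : W} (hw : w ∈ T.clocked c) :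
    T.visitTime c (Sum.inr (T.cross c.next w)) = T.visitTime c (Sum.inr (T.cross c w)) + 1 := by
  have hstep : T.perimeterStep c (T.clocked c) (Sum.inr (T.cross c w)) =
      Sum.inr (T.cross c.next w) := by
    rw [T.perimeterStep_of_mem (by simpa using hw)]
    simp
  rw [← hstep, visitTime_perimeterStep (by simp [hstep])]

theorem visitTime_cross_next_of_notMem {w : W} (hw : w ∉ T.clocked c) :
    T.visitTime c (Sum.inr (T.cross c.next w)) = T.visitTime c (Sum.inl w) + 1 := by
  have hstep : T.perimeterStep c (T.clocked c) (Sum.inl w) = Sum.inr (T.cross c.next w) :=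
    T.perimeterStep_of_notMem hw
  rw [← hstep, visitTime_perimeterStep (by simp [hstep])]

theorem visitTime_inl_of_mem {w x : W} (hw : w ∈ T.clocked c)
    (hx : T.cross c.prev x = T.cross c w) (hout : x ≠ T.outer) :
    T.visitTime c (Sum.inl x) = T.visitTime c (Sum.inl w) + 1 := by
  have hstep : T.perimeterStep c (T.clocked c) (Sum.inl w) = Sum.inl x := by
    rw [T.perimeterStep_of_mem (by simpa using hw)]
    simp [← hx]
  rw [← hstep, visitTime_perimeterStep (by simpa [hstep] using hout)]

theorem visitTime_inl_of_notMem {w x : W} (hw : w ∉ T.clocked c)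
    (hx : T.cross c.prev x = T.cross c w) (hout : x ≠ T.outer) :
    T.visitTime c (Sum.inl x) = T.visitTime c (Sum.inr (T.cross c w)) + 1 := by
  have hstep : T.perimeterStep c (T.clocked c) (Sum.inr (T.cross c w)) = Sum.inl x := by
    rw [T.perimeterStep_of_notMem (by simpa using hw)]
    simp [← hx]
  rw [← hstep, visitTime_perimeterStep (by simpa [hstep] using hout)]

theorem visitTime_tail_lt_of_head_eq {w w' : W} (hw : w ∈ T.clocked c) (hne : w' ≠ w)
    (hh : T.head c w' = T.head c w) :
    T.visitTime c (Sum.inr (T.cross c w)) < T.visitTime c (Sum.inr (T.cross c w')) := by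
  by_contra! hle
  have hhead := (selectedAt_iff.1 (selectedAt_visitTime hw)).2
  have hw' : w' ∈ T.clocked c := mem_clocked_iff.2 ⟨_, selectedAt_iff.2
    ⟨pos_visitTime _, fun ⟨j, hj, hv⟩ => hhead ⟨j, hj.trans hle, hv.trans hh⟩⟩⟩
  exact hne (eq_of_mem_clocked hw' hw hh)

end Finite

/-! ### The Tutte matching of a search -/

variable (T) in
open Classical in
/-- The colour of the vertex to which a white triangle is matched by the clocked arborescence `A` of
`G_c^*` and by the tree of the edges that do not cross `A`, directed away from the other two roots.
The value at the outer triangle has no meaning. -/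
noncomputable def matchColour (c : Colour) (w : W) : Colour :=
  if w ∈ T.clocked c then c
  else if T.visitTime c (Sum.inl w) < T.visitTime c (Sum.inr (T.cross c w)) then c.prev
  else c.next

theorem matchColour_eq_self_iff {w : W} : T.matchColour c w = c ↔ w ∈ T.clocked c := by
  unfold matchColour
  split_ifs <;> simp [*]

variable (T) in
/-- The vertex of the colour `M w` of a white triangle `w`. -/
def matchVertex (M : W → Colour) (w : W) : T.AnyVertex := ⟨M w, T.vertexOf (M w) (Sum.inl w)⟩

variable (T) in
/-- A Tutte matching, encoded by the colours of the vertices to which the white triangles are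
matched. The colour of the outer triangle is arbitrary. -/
def IsTutteColouring (M : W → Colour) : Prop :=
  Set.BijOn (T.matchVertex M) {w | w ≠ T.outer} {v | v.2 ≠ T.root v.1}

theorem matchVertex_eq_iff {M : W → Colour} {w : W} {v : T.Vertex c} :
    T.matchVertex M w = ⟨c, v⟩ ↔ M w = c ∧ T.vertexOf c (Sum.inl w) = v := by
  rw [matchVertex, Sigma.mk.inj_iff]
  constructor
  · rintro ⟨rfl, h⟩
    exact ⟨rfl, eq_of_heq h⟩
  · rintro ⟨rfl, rfl⟩
    exact ⟨rfl, HEq.rfl⟩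

theorem IsTutteColouring.isTutteMatching {M : W → Colour} (hM : T.IsTutteColouring M) :
    T.IsTutteMatching {p | p.1 ≠ T.outer ∧ T.matchVertex M p.1 = p.2} := by
  refine ⟨?_, fun w hw => ⟨T.matchVertex M w, ⟨hw, rfl⟩, fun v hv => hv.2.symm⟩, fun v hv => ?_⟩
  · rintro ⟨w, v⟩ ⟨hw, hwv⟩
    obtain rfl : T.matchVertex M w = v := hwv
    exact ⟨hw, hM.mapsTo hw, rfl⟩
  · obtain ⟨w, hw, hwv⟩ := hM.surjOn hv
    exact ⟨w, ⟨hw, hwv⟩, fun w' hw' => hM.injOn hw'.1 hw (hw'.2.trans hwv.symm)⟩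

theorem ne_outer_of_matchVertex_eq {M : W → Colour} {w : W} {v : T.AnyVertex}
    (hv : v.2 ≠ T.root v.1) (h : T.matchVertex M w = v) : w ≠ T.outer := by
  rintro rfl
  exact hv (h ▸ rfl)

theorem IsTutteColouring.vertexOf_ne_root {M : W → Colour} (hM : T.IsTutteColouring M) {w : W}
    (hw : w ≠ T.outer) (hm : M w = c) : T.vertexOf c (Sum.inl w) ≠ T.root c := by
  subst hm
  exact hM.mapsTo hw

theorem IsTutteColouring.eq_of_matchVertex_eq {M : W → Colour} (hM : T.IsTutteColouring M)
    {w w' : W} (hw : w ≠ T.outer) (hm : M w = c)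
    (hw' : T.matchVertex M w' = ⟨c, T.vertexOf c (Sum.inl w)⟩) : w' = w :=
  hM.injOn (ne_outer_of_matchVertex_eq (hM.vertexOf_ne_root hw hm) hw') hw
    (hw'.trans (matchVertex_eq_iff.2 ⟨hm, rfl⟩).symm)

section Finite

variable [Finite W] [Finite B]

variable (T) in
theorem card_anyVertex : Nat.card T.AnyVertex = Nat.card W + 2 := by
  have euler := T.spherical
  rw [Trinity.eulerChar, Nat.card_sum, Nat.card_prod, Colour.card_eq_three,
    ← Nat.card_congr (T.cross .red)] at euler
  push_cast at euler
  omega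

variable (T) in
theorem ncard_nonroot : {v : T.AnyVertex | v.2 ≠ T.root v.1}.ncard + 1 = Nat.card W := by
  let rootOf : Colour → T.AnyVertex := fun c => ⟨c, T.root c⟩
  have hrange : {v : T.AnyVertex | v.2 ≠ T.root v.1} = (Set.range rootOf)ᶜ := by
    ext ⟨c, v⟩
    simp [rootOf, Sigma.ext_iff, eq_comm]
  have hroots : (Set.range rootOf).ncard = 3 := by
    rw [Set.ncard_range_of_injective fun c d h => congrArg Sigma.fst h, Colour.card_eq_three]
  have hcompl := Set.ncard_add_ncard_compl (Set.range rootOf)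
  rw [hroots, card_anyVertex, ← hrange] at hcompl
  omega

/-- The search passes the triangle `w` just before the first black triangle at `v`. -/
theorem exists_visitTime_lt_black (v : T.Vertex c.prev) :
    ∃ w, T.matchVertex (T.matchColour c) w = ⟨c.prev, v⟩ ∧
      ∀ b, T.vertexOf c.prev (Sum.inr b) = v →
        T.visitTime c (Sum.inl w) < T.visitTime c (Sum.inr b) := by
  obtain ⟨w, hw, hmin⟩ : ∃ w, T.vertexOf c.prev (Sum.inl w) = v ∧
      ∀ b, T.vertexOf c.prev (Sum.inr b) = v →
        T.visitTime c (Sum.inr (T.cross c.next w)) ≤ T.visitTime c (Sum.inr b) := by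
    obtain ⟨w₀, hw₀⟩ := T.exists_vertexOf_inl_eq v
    obtain ⟨b, hb, hmin⟩ := Set.exists_min_image {b | T.vertexOf c.prev (Sum.inr b) = v}
      (fun b => T.visitTime c (Sum.inr b)) (Set.toFinite _)
      ⟨T.cross c w₀, (T.vertexOf_cross c.prev_ne.symm w₀).trans hw₀⟩
    obtain ⟨w, rfl⟩ := (T.cross c.next).surjective b
    exact ⟨w, (T.vertexOf_cross c.next_ne_prev w).symm.trans hb, hmin⟩
  have hcross := hmin (T.cross c w) ((T.vertexOf_cross c.prev_ne.symm w).trans hw)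
  by_cases hA : w ∈ T.clocked c
  · rw [visitTime_cross_next_of_mem hA] at hcross
    omega
  · rw [visitTime_cross_next_of_notMem hA] at hcross hmin
    exact ⟨w, matchVertex_eq_iff.2
      ⟨by rw [matchColour, if_neg hA, if_pos (Nat.lt_of_succ_le hcross)], hw⟩, hmin⟩

/-- The search passes the black triangle `T.cross c w` just before the first white triangle
at `v`. -/
theorem exists_visitTime_lt_white {v : T.Vertex c.next} (hv : v ≠ T.root c.next) :
    ∃ w, T.matchVertex (T.matchColour c) w = ⟨c.next, v⟩ ∧
      ∀ x, T.vertexOf c.next (Sum.inl x) = v →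
        T.visitTime c (Sum.inr (T.cross c w)) < T.visitTime c (Sum.inl x) := by
  obtain ⟨x, rfl, hmin⟩ : ∃ x, T.vertexOf c.next (Sum.inl x) = v ∧ ∀ x',
      T.vertexOf c.next (Sum.inl x') = v → T.visitTime c (Sum.inl x) ≤ T.visitTime c (Sum.inl x') :=
    Set.exists_min_image {x | T.vertexOf c.next (Sum.inl x) = v}
      (fun x => T.visitTime c (Sum.inl x)) (Set.toFinite _) (T.exists_vertexOf_inl_eq v)
  have hout : x ≠ T.outer := fun h => hv (h ▸ rfl)
  obtain ⟨w, hwx⟩ := (T.cross c).surjective (T.cross c.prev x)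
  have hw : T.vertexOf c.next (Sum.inl w) = T.vertexOf c.next (Sum.inl x) := by
    rw [← T.vertexOf_cross c.next_ne.symm, hwx, T.vertexOf_cross c.next_ne_prev.symm]
  have hle := hmin w hw
  by_cases hA : w ∈ T.clocked c
  · rw [visitTime_inl_of_mem hA hwx.symm hout] at hle
    omega
  · rw [visitTime_inl_of_notMem hA hwx.symm hout] at hle hmin
    exact ⟨w, matchVertex_eq_iff.2
      ⟨by rw [matchColour, if_neg hA, if_neg (Nat.lt_of_succ_le hle).not_gt], hw⟩, hmin⟩

variable (T) in
theorem isTutteColouring_matchColour (c : Colour) : T.IsTutteColouring (T.matchColour c) := by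
  refine bijOn_of_surjOn_of_ncard_le (Set.toFinite _) ?_ fun ⟨d, v⟩ hv => ?_
  · have hcompl := Set.ncard_add_ncard_compl {T.outer}
    rw [Set.ncard_singleton] at hcompl
    have hcard : ({T.outer}ᶜ : Set W).ncard ≤ {v : T.AnyVertex | v.2 ≠ T.root v.1}.ncard := by
      have := T.ncard_nonroot
      omega
    exact hcard
  suffices ∃ w, T.matchVertex (T.matchColour c) w = ⟨d, v⟩ by
    obtain ⟨w, hw⟩ := this
    exact ⟨w, ne_outer_of_matchVertex_eq hv hw, hw⟩
  rcases c.eq_or_eq_next_or_eq_prev d with rfl | rfl | rfl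
  · obtain ⟨w, hw, hwv⟩ := exists_mem_clocked_head_eq hv
    exact ⟨w, matchVertex_eq_iff.2 ⟨matchColour_eq_self_iff.2 hw, hwv⟩⟩
  · obtain ⟨w, hw, -⟩ := exists_visitTime_lt_white hv
    exact ⟨w, hw⟩
  · obtain ⟨w, hw, -⟩ := exists_visitTime_lt_black v
    exact ⟨w, hw⟩

theorem visitTime_lt_black {w : W} (hw : w ≠ T.outer) (hm : T.matchColour c w = c.prev) {b : B}
    (hb : T.vertexOf c.prev (Sum.inr b) = T.vertexOf c.prev (Sum.inl w)) :
    T.visitTime c (Sum.inl w) < T.visitTime c (Sum.inr b) := by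
  have hM := T.isTutteColouring_matchColour c
  obtain ⟨w', hw', hlt⟩ := exists_visitTime_lt_black (T.vertexOf c.prev (Sum.inl w))
  obtain rfl := hM.eq_of_matchVertex_eq hw hm hw'
  exact hlt b hb

theorem visitTime_lt_white {w x : W} (hw : w ≠ T.outer) (hm : T.matchColour c w = c.next)
    (hx : T.vertexOf c.next (Sum.inl x) = T.vertexOf c.next (Sum.inl w)) :
    T.visitTime c (Sum.inr (T.cross c w)) < T.visitTime c (Sum.inl x) := by
  have hM := T.isTutteColouring_matchColour c
  obtain ⟨w', hw', hlt⟩ := exists_visitTime_lt_white (hM.vertexOf_ne_root hw hm)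
  obtain rfl := hM.eq_of_matchVertex_eq hw hm hw'
  exact hlt x hx

end Finite

/-! ### Regions entered only at corners of a matching -/

variable (T) in
/-- Turning counter-clockwise around any vertex, the set `S` of black triangles is entered only at
corners of the matching `M`: the white triangle passed on entering is matched to the vertex. -/
def EntersOnlyAt (M : W → Colour) (S : Set B) : Prop :=
  ∀ w d, T.cross (Colour.next d) w ∈ S → T.cross (Colour.prev d) w ∉ S → M w = d

variable (T) in
/-- The minimality of a matching under the clock moves: no nonempty region that avoids the
neighbours of the outer triangle is entered only at corners of the matching. -/
def IsClocked (M : W → Colour) : Prop :=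
  ∀ S : Set B, (∀ d, T.cross d T.outer ∉ S) → T.EntersOnlyAt M S → S = ∅

theorem exists_clocked_of_leaving [Finite W] {S : Set B}
    (hS : T.EntersOnlyAt (T.matchColour c) S) {x : W} (hprev : T.cross c.prev x ∈ S)
    (hnext : T.cross c.next x ∉ S) :
    ∃ w ∈ T.clocked c, w ≠ x ∧ T.head c w = T.head c x ∧ T.cross c.next w ∈ S := by
  obtain ⟨w, hw, hwnext, hwprev⟩ := T.exists_entering_of_leaving hprev hnext
  exact ⟨w, matchColour_eq_self_iff.1 (hS w c hwnext hwprev), by rintro rfl; exact hnext hwnext,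
    hw, hwnext⟩

section Finite

variable [Finite W] [Finite B]

/-- Going around the vertex of colour `c.prev` of `x`, then around the vertex of colour `c.next` of
the white triangle `w` found there, leads to an earlier triangle of the same kind as `x`. Otherwise
`S` would be left around a vertex of colour `c`, whose selected arrow is traversed so early that the
search enters `S` before the time `N`. -/
theorem exists_visitTime_lt_of_entersOnlyAt {S : Set B} (hout : ∀ d, T.cross d T.outer ∉ S)
    (hS : T.EntersOnlyAt (T.matchColour c) S) {N : ℕ}
    (hN : ∀ b ∈ S, N ≤ T.visitTime c (Sum.inr b)) {x : W} (hnext : T.cross c.next x ∈ S)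
    (hself : T.cross c x ∉ S) (hlt : T.visitTime c (Sum.inr (T.cross c x)) < N) :
    ∃ x', T.cross c.next x' ∈ S ∧ T.cross c x' ∉ S ∧
      T.visitTime c (Sum.inr (T.cross c x')) < T.visitTime c (Sum.inr (T.cross c x)) := by
  have le_tail {w : W} (hw : w ∈ T.clocked c) (hwS : T.cross c.next w ∈ S) :
      N ≤ T.visitTime c (Sum.inr (T.cross c w)) + 1 :=
    visitTime_cross_next_of_mem hw ▸ hN _ hwS
  have ne_outer {w : W} {d : Colour} (hw : T.cross d w ∈ S) : w ≠ T.outer := by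
    rintro rfl
    exact hout d hw
  obtain ⟨w, hw, hwself, hwnext⟩ := T.exists_entering_of_leaving (c := c.prev) (w := x)
    (by rwa [c.prev_prev]) (by rwa [c.prev_next])
  have hwx := visitTime_lt_black (ne_outer hwself) (hS w _ hwself hwnext)
    ((T.vertexOf_cross c.prev_ne.symm x).trans hw.symm)
  rw [c.prev_next] at hwself
  rw [c.prev_prev] at hwnext
  have hwprev : T.cross c.prev w ∉ S := by
    intro hwprev
    obtain ⟨a, ha, -, haw, haS⟩ := exists_clocked_of_leaving hS hwprev hwnext
    have := visitTime_tail_lt ha (T.pos_surjective c (Sum.inl w)) haw.symm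
    have := le_tail ha haS
    omega
  obtain ⟨x', hx', hx'prev, hx'self⟩ := T.exists_entering_of_leaving (c := c.next) (w := w)
    (by rwa [c.next_prev]) (by rwa [c.next_next])
  have hx'w := visitTime_lt_white (ne_outer hx'prev) (hS x' _ hx'prev hx'self) hx'.symm
  rw [c.next_next] at hx'prev
  rw [c.next_prev] at hx'self
  refine ⟨x', ?_, hx'self, hx'w.trans hwx⟩
  by_contra hx'next
  obtain ⟨a, ha, hne, hax', haS⟩ := exists_clocked_of_leaving hS hx'prev hx'next
  have := visitTime_tail_lt_of_head_eq ha hne.symm hax'.symm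
  have := le_tail ha haS
  omega

theorem le_visitTime_tail_of_entersOnlyAt {S : Set B} (hout : ∀ d, T.cross d T.outer ∉ S)
    (hS : T.EntersOnlyAt (T.matchColour c) S) {N : ℕ}
    (hN : ∀ b ∈ S, N ≤ T.visitTime c (Sum.inr b)) {x : W} (hnext : T.cross c.next x ∈ S)
    (hself : T.cross c x ∉ S) : N ≤ T.visitTime c (Sum.inr (T.cross c x)) := by
  by_contra! hlt
  obtain ⟨x, ⟨hnext, hself, hlt⟩, hmin⟩ := Set.exists_min_image
    {x | T.cross c.next x ∈ S ∧ T.cross c x ∉ S ∧ T.visitTime c (Sum.inr (T.cross c x)) < N}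
    (fun x => T.visitTime c (Sum.inr (T.cross c x))) (Set.toFinite _) ⟨x, hnext, hself, hlt⟩
  obtain ⟨x', hx'next, hx'self, hx'⟩ :=
    exists_visitTime_lt_of_entersOnlyAt hout hS hN hnext hself hlt
  exact hx'.not_ge (hmin x' ⟨hx'next, hx'self, hx'.trans hlt⟩)

theorem visitTime_cross_prev_lt {w : W} (hw : w ≠ T.outer) :
    T.visitTime c (Sum.inr (T.cross c.prev w)) < T.visitTime c (Sum.inl w) := by
  obtain ⟨x, hx⟩ := (T.cross c).surjective (T.cross c.prev w)
  rw [← hx]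
  by_cases hA : x ∈ T.clocked c
  · have := visitTime_tail_lt hA (T.pos_surjective c (Sum.inl x)) rfl
    have := visitTime_inl_of_mem hA hx.symm hw
    omega
  · exact (visitTime_inl_of_notMem hA hx.symm hw).symm ▸ Nat.lt_succ_self _

variable (T) in
theorem isClocked_matchColour (c : Colour) : T.IsClocked (T.matchColour c) := by
  intro S hout hS
  by_contra hne
  obtain ⟨b, hb, hmin⟩ := Set.exists_min_image S (fun b => T.visitTime c (Sum.inr b))
    (Set.toFinite _) (Set.nonempty_iff_ne_empty.2 hne)
  obtain ⟨w, rfl⟩ := (T.cross c.next).surjective b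
  by_cases hA : w ∈ T.clocked c
  · have hlt : T.visitTime c (Sum.inr (T.cross c w)) <
        T.visitTime c (Sum.inr (T.cross c.next w)) := by
      rw [visitTime_cross_next_of_mem hA]
      exact Nat.lt_succ_self _
    exact hlt.not_ge (le_visitTime_tail_of_entersOnlyAt hout hS hmin hb
      fun hself => hlt.not_ge (hmin _ hself))
  · have hlt : T.visitTime c (Sum.inr (T.cross c.prev w)) <
        T.visitTime c (Sum.inr (T.cross c.next w)) := by
      rw [visitTime_cross_next_of_notMem hA]
      exact (visitTime_cross_prev_lt (by rintro rfl; exact hout _ hb)).trans (Nat.lt_succ_self _)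
    exact hA (matchColour_eq_self_iff.1 (hS w c hb fun hprev => hlt.not_ge (hmin _ hprev)))

end Finite

end PlanarTrinity

/-! ### Gradients and flows -/

namespace Trinity

variable {W B : Type*} (T : Trinity W B)

/-- The change of a function of the black triangles across each corner of a white triangle, in the
counter-clockwise direction around its vertex. A pair `(w, c)` stands for the corner of `w` at its
vertex of colour `c`. -/
def gradient : (B → ℚ) →ₗ[ℚ] (W × Colour → ℚ) :=
  LinearMap.funLeft ℚ ℚ (fun p => T.cross p.2.next p.1) -
    LinearMap.funLeft ℚ ℚ (fun p => T.cross p.2.prev p.1)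

/-- A function of the vertices and a function of the white triangles, added up at each corner of a
white triangle, where corners are encoded as in `gradient`. This is the transpose of the map that
takes a flow through the corners to its divergences at the vertices and at the white triangles. -/
def cornerSum : ((T.AnyVertex → ℚ) × (W → ℚ)) →ₗ[ℚ] (W × Colour → ℚ) :=
  (LinearMap.funLeft ℚ ℚ fun p : W × Colour =>
    (⟨p.2, T.vertexOf p.2 (Sum.inl p.1)⟩ : T.AnyVertex)).coprod (LinearMap.funLeft ℚ ℚ Prod.fst)

theorem gradient_apply (h : B → ℚ) (w : W) (c : Colour) :
    T.gradient h (w, c) = h (T.cross c.next w) - h (T.cross c.prev w) := rfl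

theorem cornerSum_apply (y : T.AnyVertex → ℚ) (x : W → ℚ) (w : W) (c : Colour) :
    T.cornerSum (y, x) (w, c) = y ⟨c, T.vertexOf c (Sum.inl w)⟩ + x w := rfl

theorem gradient_dotProduct_cornerSum [Fintype W] (h : B → ℚ)
    (p : (T.AnyVertex → ℚ) × (W → ℚ)) : T.gradient h ⬝ᵥ T.cornerSum p = 0 := by
  have := Fintype.ofEquiv W (T.cross .red)
  obtain ⟨y, x⟩ := p
  have sum_colours (w : W) : ∑ c, T.gradient h (w, c) * x w = 0 := by
    rw [← Finset.sum_mul]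
    exact mul_eq_zero_of_left (Colour.sum_next_sub_prev fun c => h (T.cross c w)) _
  have sum_triangles (c : Colour) :
      ∑ w, T.gradient h (w, c) * y ⟨c, T.vertexOf c (Sum.inl w)⟩ = 0 := by
    have sum_cross {d : Colour} (hd : d ≠ c) :
        ∑ w, h (T.cross d w) * y ⟨c, T.vertexOf c (Sum.inl w)⟩ =
          ∑ b, h b * y ⟨c, T.vertexOf c (Sum.inr b)⟩ := by
      rw [← Equiv.sum_comp (T.cross d)]
      simp only [T.vertexOf_cross hd]
    simp only [gradient_apply, sub_mul, Finset.sum_sub_distrib]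
    rw [sum_cross c.next_ne, sum_cross c.prev_ne, sub_self]
  simp only [dotProduct, Fintype.sum_prod_type, cornerSum_apply, mul_add, Finset.sum_add_distrib,
    sum_colours, add_zero]
  rw [Finset.sum_comm]
  simp only [sum_triangles, Finset.sum_const_zero]

theorem cross_eq_of_gradient_eq_zero {h : B → ℚ} {w : W} (hw : ∀ c, T.gradient h (w, c) = 0)
    (c : Colour) : h (T.cross c w) = h (T.cross .red w) := by
  have next_eq_prev (d : Colour) : h (T.cross d.next w) = h (T.cross d.prev w) :=
    sub_eq_zero.1 (hw d)
  cases c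
  exacts [rfl, next_eq_prev .blue, (next_eq_prev .green).symm]

theorem eq_of_gradient_eq_zero {h : B → ℚ} (hh : T.gradient h = 0) (b b' : B) : h b = h b' := by
  have cross_red (c : Colour) (w : W) : h (T.cross .red w) = h (T.cross c w) :=
    (T.cross_eq_of_gradient_eq_zero (fun d => congrFun hh (w, d)) c).symm
  exact T.eq_of_cross_invariant (Sum.elim (fun w => h (T.cross .red w)) h) cross_red
    (Sum.inr b) (Sum.inr b')

theorem eq_of_cornerSum_eq_zero {y : T.AnyVertex → ℚ} {x : W → ℚ} (hyx : T.cornerSum (y, x) = 0)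
    (w w' : W) : x w = x w' := by
  have eq_neg (c : Colour) (w : W) : x w = - y ⟨c, T.vertexOf c (Sum.inl w)⟩ :=
    eq_neg_of_add_eq_zero_right (congrFun hyx (w, c))
  refine T.eq_of_cross_invariant (Sum.elim x fun b => x ((T.cross .red).symm b)) (fun c w => ?_)
    (Sum.inl w) (Sum.inl w')
  -- White triangles next to the same black triangle share one of its vertices.
  obtain ⟨w', hw'⟩ := (T.cross .red).surjective (T.cross c w)
  obtain ⟨e, hce, hre⟩ := Colour.exists_ne_and_ne c .red
  simp only [Sum.elim_inl, Sum.elim_inr, ← hw', Equiv.symm_apply_apply]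
  rw [eq_neg e w, eq_neg e w', ← T.vertexOf_cross hce, ← hw', T.vertexOf_cross hre]

end Trinity

namespace PlanarTrinity

variable {W B : Type*} {T : PlanarTrinity W B} {c : Colour}

variable (T) in
theorem finrank_ker_gradient_le_one : Module.finrank ℚ (T.gradient).ker ≤ 1 := by
  have hinj : Function.Injective
      ((LinearMap.proj (T.cross .red T.outer)).comp (T.gradient).ker.subtype) := by
    refine (injective_iff_map_eq_zero _).2 fun ⟨h, hh⟩ h0 => Subtype.ext (funext fun b => ?_)
    exact (T.eq_of_gradient_eq_zero hh b _).trans h0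
  exact (LinearMap.finrank_le_finrank_of_injective hinj).trans_eq (Module.finrank_self ℚ)

variable (T) in
theorem finrank_ker_cornerSum_le_one : Module.finrank ℚ (T.cornerSum).ker ≤ 1 := by
  have hinj : Function.Injective (((LinearMap.proj T.outer).comp (LinearMap.snd ℚ _ _)).comp
      (T.cornerSum).ker.subtype) := by
    refine (injective_iff_map_eq_zero _).2 fun ⟨⟨y, x⟩, hyx⟩ hx₀ => Subtype.ext ?_
    have hx : x = 0 := funext fun w => (T.eq_of_cornerSum_eq_zero hyx w _).trans hx₀
    have hy : y = 0 := by
      ext ⟨c, v⟩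
      obtain ⟨w, rfl⟩ := T.exists_vertexOf_inl_eq v
      simpa [hx, Trinity.cornerSum_apply] using congrFun hyx (w, c)
    exact Prod.ext hy hx
  exact (LinearMap.finrank_le_finrank_of_injective hinj).trans_eq (Module.finrank_self ℚ)

variable (T) in
theorem range_gradient_sup_range_cornerSum [Finite W] [Finite B] :
    (T.gradient).range ⊔ (T.cornerSum).range = ⊤ := by
  have := Fintype.ofFinite W
  have := Fintype.ofFinite B
  have := Fintype.ofFinite T.AnyVertex
  have hdisj : Disjoint (T.gradient).range (T.cornerSum).range := by
    rw [Submodule.disjoint_def]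
    rintro _ ⟨h, rfl⟩ ⟨p, hp⟩
    refine dotProduct_self_eq_zero.1 ?_
    nth_rewrite 2 [← hp]
    exact T.gradient_dotProduct_cornerSum h p
  refine Submodule.eq_top_of_disjoint _ _ ?_ hdisj
  have hB : Fintype.card B = Fintype.card W := (Fintype.card_congr (T.cross .red)).symm
  have hV := T.card_anyVertex
  have hgradient := (T.gradient).finrank_range_add_finrank_ker
  have hcornerSum := (T.cornerSum).finrank_range_add_finrank_ker
  have := T.finrank_ker_gradient_le_one
  have := T.finrank_ker_cornerSum_le_one
  simp only [Nat.card_eq_fintype_card] at hV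
  simp only [Module.finrank_prod, Module.finrank_fintype_fun_eq_card, hV, hB]
    at hgradient hcornerSum
  rw [Module.finrank_fintype_fun_eq_card, Fintype.card_prod,
    ← Nat.card_eq_fintype_card (α := Colour), Colour.card_eq_three]
  omega

/-- On the sphere, a flow through the corners without divergence is a gradient. -/
theorem exists_gradient_eq [Fintype W] [Finite B] {g : W × Colour → ℚ}
    (hg : ∀ p, g ⬝ᵥ T.cornerSum p = 0) : ∃ h, T.gradient h = g := by
  obtain ⟨_, ⟨h, rfl⟩, _, ⟨p, rfl⟩, rfl⟩ :=
    Submodule.mem_sup.1 (T.range_gradient_sup_range_cornerSum ▸ Submodule.mem_top (x := g))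
  have hp := hg p
  rw [add_dotProduct, T.gradient_dotProduct_cornerSum, zero_add] at hp
  exact ⟨h, by rw [dotProduct_self_eq_zero.1 hp, add_zero]⟩

/-! ### Uniqueness of the clocked matching -/

variable (T) in
open Classical in
/-- The corners of the non-outer white triangles at which the matching `M` matches a triangle to a
vertex, as a flow through the corners. -/
noncomputable def matchIndicator (M : W → Colour) (p : W × Colour) : ℚ :=
  if p.1 ≠ T.outer ∧ M p.1 = p.2 then 1 else 0

theorem matchIndicator_eq_one_iff {M : W → Colour} {w : W} :
    T.matchIndicator M (w, c) = 1 ↔ w ≠ T.outer ∧ M w = c := by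
  simp [matchIndicator]

theorem matchIndicator_outer (M : W → Colour) : T.matchIndicator M (T.outer, c) = 0 := by
  simp [matchIndicator]

theorem matchIndicator_nonneg (M : W → Colour) (p : W × Colour) : 0 ≤ T.matchIndicator M p := by
  unfold matchIndicator
  positivity

open Classical in
theorem IsTutteColouring.matchIndicator_dotProduct_cornerSum [Fintype W]
    {M : W → Colour} (hM : T.IsTutteColouring M) (y : T.AnyVertex → ℚ) (x : W → ℚ) :
    T.matchIndicator M ⬝ᵥ T.cornerSum (y, x) =
      ∑ᶠ v ∈ {v : T.AnyVertex | v.2 ≠ T.root v.1}, y v + ∑ w with w ≠ T.outer, x w := by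
  have sum_colours (w : W) : ∑ c, T.matchIndicator M (w, c) * T.cornerSum (y, x) (w, c) =
      if w ≠ T.outer then y (T.matchVertex M w) + x w else 0 := by
    by_cases hw : w = T.outer <;>
      simp [matchIndicator, hw, Trinity.cornerSum_apply, matchVertex]
  rw [dotProduct, Fintype.sum_prod_type, Fintype.sum_congr _ _ sum_colours, ← Finset.sum_filter,
    Finset.sum_add_distrib, ← finsum_mem_eq_of_bijOn _ hM fun _ _ => rfl,
    ← finsum_mem_coe_finset, Finset.coe_filter_univ]

theorem IsClocked.apply_le_of_gradient_eq_sub {M M' : W → Colour} (hM : T.IsClocked M) {h : B → ℚ}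
    (hh : T.gradient h = T.matchIndicator M - T.matchIndicator M') (b : B) :
    h b ≤ h (T.cross .red T.outer) := by
  have h_outer := T.cross_eq_of_gradient_eq_zero (h := h) (w := T.outer) fun d => by
    rw [hh, Pi.sub_apply, matchIndicator_outer, matchIndicator_outer, sub_self]
  have hempty : {b | h (T.cross .red T.outer) < h b} = ∅ := by
    refine hM _ (fun d => (h_outer d).not_gt) fun w d hnext hprev => ?_
    have hpos : 0 < T.gradient h (w, d) :=
      sub_pos.2 ((not_lt.1 hprev).trans_lt hnext)
    by_contra hne
    have hzero : T.matchIndicator M (w, d) = 0 := if_neg fun hw => hne hw.2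
    rw [hh, Pi.sub_apply, hzero, zero_sub] at hpos
    exact (neg_nonpos.2 (matchIndicator_nonneg M' _)).not_gt hpos
  exact not_lt.1 fun hb => Set.eq_empty_iff_forall_notMem.1 hempty b hb

variable [Finite W] [Finite B]

theorem IsTutteColouring.exists_gradient_eq_sub {M M' : W → Colour} (hM : T.IsTutteColouring M)
    (hM' : T.IsTutteColouring M') :
    ∃ h, T.gradient h = T.matchIndicator M - T.matchIndicator M' := by
  have := Fintype.ofFinite W
  refine exists_gradient_eq fun ⟨y, x⟩ => ?_
  rw [sub_dotProduct, hM.matchIndicator_dotProduct_cornerSum,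
    hM'.matchIndicator_dotProduct_cornerSum, sub_self]

theorem IsTutteColouring.eq_of_isClocked {M M' : W → Colour} (hM : T.IsTutteColouring M)
    (hM' : T.IsTutteColouring M') (hMc : T.IsClocked M) (hMc' : T.IsClocked M') {w : W}
    (hw : w ≠ T.outer) : M w = M' w := by
  obtain ⟨h, hh⟩ := hM.exists_gradient_eq_sub hM'
  have hneg : T.gradient (-h) = T.matchIndicator M' - T.matchIndicator M := by
    rw [map_neg, hh, neg_sub]
  have hconst (b : B) : h b = h (T.cross .red T.outer) :=
    (hMc.apply_le_of_gradient_eq_sub hh b).antisymm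
      (neg_le_neg_iff.1 (hMc'.apply_le_of_gradient_eq_sub hneg b))
  have hgradient : T.gradient h (w, M w) = 0 := by
    rw [T.gradient_apply, hconst, hconst (T.cross _ w), sub_self]
  rw [hh, Pi.sub_apply, sub_eq_zero, matchIndicator_eq_one_iff.2 ⟨hw, rfl⟩] at hgradient
  exact (matchIndicator_eq_one_iff.1 hgradient.symm).2.symm

theorem matchColour_eq_matchColour (c d : Colour) {w : W} (hw : w ≠ T.outer) :
    T.matchColour c w = T.matchColour d w :=
  (T.isTutteColouring_matchColour c).eq_of_isClocked (T.isTutteColouring_matchColour d)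
    (T.isClocked_matchColour c) (T.isClocked_matchColour d) hw

theorem iUnion_asMatching_clocked (d : Colour) :
    ⋃ c, T.asMatching c (T.clocked c) =
      {p | p.1 ≠ T.outer ∧ T.matchVertex (T.matchColour d) p.1 = p.2} := by
  ext ⟨w, c, v⟩
  have mem_iff (hw : w ≠ T.outer) : w ∈ T.clocked c ↔ T.matchColour d w = c := by
    rw [matchColour_eq_matchColour d c hw, matchColour_eq_self_iff]
  simp only [Set.mem_iUnion, Set.mem_ofPred_eq, matchVertex_eq_iff]
  constructor
  · rintro ⟨c', w', hw', heq⟩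
    obtain ⟨rfl, rfl, rfl⟩ : w = w' ∧ c = c' ∧ _ := by simpa [Sigma.ext_iff] using heq
    have hne : w ≠ T.outer := by
      rintro rfl
      exact head_ne_root_of_mem_clocked hw' rfl
    exact ⟨hne, (mem_iff hne).1 hw', rfl⟩
  · rintro ⟨hne, hm, rfl⟩
    exact ⟨c, w, (mem_iff hne).2 hm, rfl⟩

end PlanarTrinity

theorem corollary4p8 {W B : Type*} [Finite W] [Finite B] (T : PlanarTrinity W B) :
    (∀ c : Colour, T.IsSpanningArborescence c (T.clocked c)) ∧
      T.IsTutteMatching (⋃ c : Colour, T.asMatching c (T.clocked c)) := by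
  refine ⟨T.isSpanningArborescence_clocked, ?_⟩
  rw [PlanarTrinity.iUnion_asMatching_clocked .red]
  exact (T.isTutteColouring_matchColour .red).isTutteMatching
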